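/- Let $\mathcal M=(S,\mathit{Act},\gamma,\lambda,\mathit{rew},\delta)$ be a Markov decision process with finite sets $S$ of states and $\mathit{Act}$ of actions, nonempty sets $\gamma(s)\subseteq\mathit{Act}$ of enabled actions, labels $\lambda(s)\subseteq\mathrm{AP}$ (a set of atomic propositions), rewards $\mathit{rew}(s)\in\mathbb R_{\ge 0}$, and transition probabilities $\delta(s,\alpha,\cdot)$ on $S$. A scheduler $\sigma$ maps every nonempty finite sequence of states to an action enabled in its last state; $\Pr_s^\sigma$ is the induced probability measure on the infinite paths that start in $s$. For $a,b\in\mathrm{AP}$ and $r\in\mathbb R$, a path $s_0s_1s_2\ldots$ fulfils $a\,\mathsf U_{\le r}\,b$ if there is a $k\ge 0$ with $b\in\lambda(s_k)$, $a\in\lambda(s_i)$ for all $i<k$, and $\sum_{i<k}\mathit{rew}(s_i)\le r$. A quantile query is $\phi=Q(a\,\mathsf U_{\le ?}\,b)$ with $Q\in\{\forall\mathsf P_{\bowtie p},\exists\mathsf P_{\bowtie p}\}$, ${\bowtie}\in\{<,\le,\ge,>\}$ and $p\in[0,1]$; it is qualitative if $p\in\{0,1\}$. A state $s$ satisfies $\phi[r]$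 if $\Pr_s^\sigma(a\,\mathsf U_{\le r}\,b)\bowtie p$ holds for all schedulers $\sigma$ (if $Q=\forall\mathsf P_{\bowtie p}$), respectively for some scheduler $\sigma$ (if $Q=\exists\mathsf P_{\bowtie p}$). The value $\mathrm{val}_\phi(s)\in\mathbb R\cup\{\pm\infty\}$ is $\inf\{r\in\mathbb R: s\models\phi[r]\}$ if ${\bowtie}\in\{\ge,>\}$ and $\sup\{r\in\mathbb R: s\models\phi[r]\}$ if ${\bowtie}\in\{<,\le\}$, where $\inf\emptyset=\infty$ and $\sup\emptyset=-\infty$. Let $\phi=Q(a\,\mathsf U_{\le ?}\,b)$ be a qualitative quantile query, let $n$ be the number of states labelled with $a$, and let $c$ be the largest reward of a state labelled with $a$ ($c=0$ if there is no such state). Then $\mathrm{val}_\phi(s)\le n\,c$ for every state $s$ with $\mathrm{val}_\phi(s)<\infty$. -/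

import Mathlib

open MeasureTheory ProbabilityTheory
open scoped NNReal

noncomputable section

/-- A Markov decision process with states `S`, actions `Act`, atomic propositions `AP` and
nonnegative rewards on states. -/
structure MDP (S Act AP : Type*) where
  /-- The actions that are enabled in a state. -/
  enabled : S → Set Act
  enabled_nonempty : ∀ s, (enabled s).Nonempty
  /-- The atomic propositions that hold in a state. -/
  label : S → Set AP
  /-- The reward of a state, earned upon leaving it. -/
  rew : S → ℝ≥0
  /-- The distribution of the successor state. -/
  trans : S → Act → PMF S

/-- A quantile query asks either about all schedulers or about some scheduler. -/
inductive PathQuantifier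
  | all
  | ex

/-- The four comparison operators that may stand in front of the probability bound. -/
inductive Comparison
  | lt
  | le
  | ge
  | gt

/-- `c.Holds x p` says that `x` compares with `p` as `c` prescribes. -/
def Comparison.Holds : Comparison → ℝ → ℝ → Prop
  | .lt, x, p => x < p
  | .le, x, p => x ≤ p
  | .ge, x, p => x ≥ p
  | .gt, x, p => x > p

/-- A quantile query: a path quantifier with a comparison operator and a probability bound in
`[0, 1]`, applied to the path property `lhs U_{≤ ?} rhs`. -/
structure QuantileQuery (AP : Type*) where
  quant : PathQuantifier
  cmp : Comparison
  bound : unitInterval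
  lhs : AP
  rhs : AP

/-- A query is qualitative if its probability bound is `0` or `1`. -/
def QuantileQuery.IsQualitative {AP : Type*} (φ : QuantileQuery AP) : Prop :=
  φ.bound = 0 ∨ φ.bound = 1

namespace MDP

variable {S Act AP : Type*}

/-- A scheduler maps each nonempty sequence of states, given as an initial part `x` and a last
state `s`, to an action that is enabled in `s`. -/
structure Scheduler (M : MDP S Act AP) where
  act : List S → S → Act
  act_mem : ∀ (x : List S) (s : S), act x s ∈ M.enabled s

/-- The action that `σ` picks after the history `h 0, …, h n`. -/
def Scheduler.actAfter {M : MDP S Act AP} (σ : M.Scheduler) (n : ℕ)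
    (h : Finset.Iic n → S) : Act :=
  σ.act (List.ofFn fun i : Fin n => h ⟨i, Finset.mem_Iic.2 i.isLt.le⟩)
    (h ⟨n, Finset.mem_Iic.2 le_rfl⟩)

section Measure

variable [Finite S] [MeasurableSpace S] [DiscreteMeasurableSpace S]

/-- The distribution of the next state given the history `h 0, …, h n`. -/
def stepKernel (M : MDP S Act AP) (σ : M.Scheduler) (n : ℕ) :
    Kernel (Finset.Iic n → S) S where
  toFun h := (M.trans (h ⟨n, Finset.mem_Iic.2 le_rfl⟩) (σ.actAfter n h)).toMeasure
  measurable' := measurable_of_countable _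

instance (M : MDP S Act AP) (σ : M.Scheduler) (n : ℕ) :
    IsMarkovKernel (M.stepKernel σ n) :=
  ⟨fun h => PMF.toMeasure.isProbabilityMeasure
    (M.trans (h ⟨n, Finset.mem_Iic.2 le_rfl⟩) (σ.actAfter n h))⟩

/-- The probability measure on infinite paths that the scheduler `σ` induces from the initial
state `s`. -/
def pathMeasure (M : MDP S Act AP) (σ : M.Scheduler) (s : S) : Measure (ℕ → S) :=
  Kernel.traj (X := fun _ => S) (M.stepKernel σ) 0 (fun _ => s)

end Measure

/-- The paths that fulfil `a U_{≤ r} b`. -/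
def untilLE (M : MDP S Act AP) (a b : AP) (r : ℝ) : Set (ℕ → S) :=
  {π | ∃ k : ℕ, b ∈ M.label (π k) ∧ (∀ i < k, a ∈ M.label (π i)) ∧
    ∑ i ∈ Finset.range k, (M.rew (π i) : ℝ) ≤ r}

section Query

variable [Finite S] [MeasurableSpace S] [DiscreteMeasurableSpace S]

/-- `M.Sat s φ r` says that the state `s` satisfies `φ[r]`, the formula that arises from the
query `φ` by replacing `?` with `r`. -/
def Sat (M : MDP S Act AP) (s : S) (φ : QuantileQuery AP) (r : ℝ) : Prop :=
  match φ.quant with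
  | .all => ∀ σ : M.Scheduler,
      φ.cmp.Holds ((M.pathMeasure σ s).real (M.untilLE φ.lhs φ.rhs r)) φ.bound
  | .ex => ∃ σ : M.Scheduler,
      φ.cmp.Holds ((M.pathMeasure σ s).real (M.untilLE φ.lhs φ.rhs r)) φ.bound

/-- The value of the state `s` with respect to the query `φ`: an infimum for `≥` and `>`, a
supremum for `<` and `≤`, both taken in the extended reals. -/
def val (M : MDP S Act AP) (φ : QuantileQuery AP) (s : S) : EReal :=
  match φ.cmp with
  | .ge | .gt => sInf ((fun r : ℝ => (r : EReal)) '' {r : ℝ | M.Sat s φ r})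
  | .lt | .le => sSup ((fun r : ℝ => (r : EReal)) '' {r : ℝ | M.Sat s φ r})

end Query

/-- The set of states labelled with `a`. -/
def labelled [Finite S] (M : MDP S Act AP) (a : AP) : Finset S :=
  (Set.toFinite {s : S | a ∈ M.label s}).toFinset

/-- The largest reward of an `a`-labelled state (`0` if there is none). -/
def maxReward [Finite S] (M : MDP S Act AP) (a : AP) : ℝ≥0 :=
  (M.labelled a).sup M.rew

end MDP

end

/-! Satisfaction of a query with `≥` or `>` is monotone in the reward bound, and a query with `<` or
`≤` is the negation of one with the dual quantifier and a lower bound. So it suffices that a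
qualitative lower-bound query that holds for some `r` also holds for `n * c`
(`sat_card_mul_maxReward`). The bounds `≥ 0` and `> 1` are trivial, which leaves positive
probability and probability one, each for all or for some scheduler. In all four cases `n * c` comes
from `sum_rew_le`: before the target is hit, no state of nonzero reward occurs twice. For positive
probability, the states from which the target can be reached (or cannot be avoided) form an
attractor. Descending along its rank gives a history without repetitions. For probability one under
all schedulers, a repeated state of nonzero reward before the first `b` could be pumped: some
scheduler would follow the loop until the reward exceeds `r`, without seeing `b`. For probability
one under some scheduler, let `v u` be the least budget left when the given scheduler reaches `u`.
Among the actions for which every possible successor's `v` is lower by at least the reward paid, a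
memoryless scheduler picks one that may approach `b`. It reaches `b` almost surely, and since `v`
pays for every reward, a repeated state has reward zero. -/

namespace MDP

variable {S Act AP : Type*}

/-! ### Schedulers, cylinders and the path measure -/

/-- The paths that agree with `x` up to time `n`. -/
def pathCylinder (n : ℕ) (x : ℕ → S) : Set (ℕ → S) :=
  {π | ∀ i ≤ n, π i = x i}

/-- The action that `σ` picks along the path `x` at time `n`. -/
def Scheduler.actAlong {M : MDP S Act AP} (σ : M.Scheduler) (x : ℕ → S) (n : ℕ) : Act :=
  σ.act (List.ofFn fun i : Fin n => x i) (x n)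

theorem Scheduler.actAlong_mem {M : MDP S Act AP} (σ : M.Scheduler) (x : ℕ → S) (n : ℕ) :
    σ.actAlong x n ∈ M.enabled (x n) :=
  σ.act_mem _ _

theorem Scheduler.actAlong_congr {M : MDP S Act AP} (σ : M.Scheduler) {x y : ℕ → S} {n : ℕ}
    (h : ∀ i ≤ n, x i = y i) : σ.actAlong x n = σ.actAlong y n := by
  unfold Scheduler.actAlong
  rw [h n le_rfl]
  congr 2
  funext i
  exact h i i.2.le

/-- The scheduler that picks an arbitrary enabled action after each history, except that it picks
`f l s` where this action is enabled. -/
noncomputable def schedulerOf (M : MDP S Act AP) (f : List S → S → Act) : M.Scheduler := by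
  classical
  exact
  { act := fun l s => if f l s ∈ M.enabled s then f l s else (M.enabled_nonempty s).some
    act_mem := fun l s => by
      split_ifs with h
      exacts [h, (M.enabled_nonempty s).some_mem] }

theorem schedulerOf_act (M : MDP S Act AP) {f : List S → S → Act} {l : List S} {s : S}
    (h : f l s ∈ M.enabled s) : (M.schedulerOf f).act l s = f l s :=
  if_pos h

theorem measurableSet_untilLE [MeasurableSpace S] [DiscreteMeasurableSpace S]
    (M : MDP S Act AP) (a b : AP) (r : ℝ) :
    MeasurableSet (M.untilLE a b r) := by
  have hm : ∀ (i : ℕ) (A : Set S), MeasurableSet {π : ℕ → S | π i ∈ A} := fun i A =>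
    measurable_pi_apply (X := fun _ : ℕ => S) i (MeasurableSet.of_discrete (s := A))
  have hr : ∀ k : ℕ, Measurable fun π : ℕ → S => ∑ i ∈ Finset.range k, (M.rew (π i) : ℝ) :=
    fun k => Finset.measurable_sum _ fun i _ =>
      (Measurable.of_discrete (f := fun u : S => (M.rew u : ℝ))).comp (measurable_pi_apply i)
  have : M.untilLE a b r = ⋃ k : ℕ, ({π : ℕ → S | π k ∈ {u | b ∈ M.label u}} ∩
      ((⋂ i ∈ Set.Iio k, {π : ℕ → S | π i ∈ {u | a ∈ M.label u}}) ∩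
      {π : ℕ → S | ∑ i ∈ Finset.range k, (M.rew (π i) : ℝ) ≤ r})) := by
    ext π; simp [untilLE]
  rw [this]
  exact MeasurableSet.iUnion fun k => (hm _ _).inter
    ((MeasurableSet.biInter (Set.to_countable _) fun i _ => hm _ _).inter
      (measurableSet_le (hr k) measurable_const))

section Measure

variable [Finite S] [MeasurableSpace S] [DiscreteMeasurableSpace S]
variable {M : MDP S Act AP}

instance (σ : M.Scheduler) (s : S) : IsProbabilityMeasure (M.pathMeasure σ s) := by
  unfold pathMeasure; infer_instance

theorem measurableSet_pathCylinder (n : ℕ) (x : ℕ → S) : MeasurableSet (pathCylinder n x) := by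
  have : pathCylinder n x = ⋂ i ∈ Set.Iic n, (fun π : ℕ → S => π i) ⁻¹' {x i} := by
    ext π; simp [pathCylinder]
  rw [this]
  exact MeasurableSet.biInter (Set.to_countable _) fun i _ =>
    measurable_pi_apply i (measurableSet_singleton _)

/-- Integrals of functions of the first `n + 2` states of a path, computed by conditioning on the
first `n + 1` states. -/
theorem lintegral_pathMeasure_succ (σ : M.Scheduler) (s : S) (n : ℕ)
    (F : (Finset.Iic n → S) → S → ENNReal) :
    ∫⁻ π, F (Preorder.frestrictLe n π) (π (n + 1)) ∂M.pathMeasure σ s =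
      ∫⁻ π, ∫⁻ t, F (Preorder.frestrictLe n π) t
        ∂(M.trans (π n) (σ.actAlong π n)).toMeasure ∂M.pathMeasure σ s := by
  have h1 := Kernel.partialTraj_compProd_eq_map_traj (X := fun _ => S) (κ := M.stepKernel σ)
    (zero_le (a := n)) (x₀ := fun _ => s)
  have h2 := Kernel.traj_map_frestrictLe_apply (X := fun _ => S) (κ := M.stepKernel σ) 0 n
    (fun _ => s)
  have hF : Measurable (Function.uncurry F) := measurable_of_countable _
  calc _ = ∫⁻ q, Function.uncurry F q ∂(M.pathMeasure σ s).map
          (fun π => (Preorder.frestrictLe n π, π (n + 1))) := by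
        rw [lintegral_map hF (by fun_prop)]; rfl
    _ = _ := by
        unfold pathMeasure
        rw [← h1, Measure.lintegral_compProd hF, ← h2, lintegral_map]
        · rfl
        · exact measurable_of_countable _
        · fun_prop

theorem pathMeasure_cylinder_zero (σ : M.Scheduler) (s : S) {x : ℕ → S} (hx : x 0 = s) :
    M.pathMeasure σ s (pathCylinder 0 x) = 1 := by
  have h2 := Kernel.traj_map_frestrictLe_apply (X := fun _ => S) (κ := M.stepKernel σ) 0 0
    (fun _ => s)
  have h3 : pathCylinder 0 x = Preorder.frestrictLe (π := fun _ : ℕ => S) 0 ⁻¹' {fun _ => s} := by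
    ext π
    simp only [pathCylinder, Set.mem_ofPred_eq, Set.mem_preimage, Set.mem_singleton_iff]
    constructor
    · intro h
      funext i
      have : (i : ℕ) = 0 := Nat.le_zero.1 (Finset.mem_Iic.1 i.2)
      simp [this, h, hx]
    · intro h i hi
      obtain rfl : i = 0 := by omega
      exact (congrFun h ⟨0, by simp⟩).trans hx.symm
  rw [h3]
  unfold pathMeasure
  rw [← Measure.map_apply (by fun_prop) (measurableSet_singleton _), h2]
  simp [Kernel.id_apply]

theorem pathMeasure_cylinder_zero_of_ne (σ : M.Scheduler) (s : S) {x : ℕ → S} (hx : x 0 ≠ s) :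
    M.pathMeasure σ s (pathCylinder 0 x) = 0 := by
  have h := pathMeasure_cylinder_zero σ s (x := fun _ => s) rfl
  rw [← prob_compl_eq_zero_iff (measurableSet_pathCylinder _ _)] at h
  refine measure_mono_null (t := (pathCylinder 0 fun _ => s)ᶜ) (fun π hπ => ?_) h
  intro (h' : π ∈ pathCylinder 0 fun _ => s)
  exact hx ((hπ 0 le_rfl).symm.trans (h' 0 le_rfl))

/-- The chain rule: condition on the first `n + 1` states and integrate the indicator of the
cylinder. -/
theorem pathMeasure_cylinder_succ (σ : M.Scheduler) (s : S) (n : ℕ) (x : ℕ → S) :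
    M.pathMeasure σ s (pathCylinder (n + 1) x) =
      M.pathMeasure σ s (pathCylinder n x) * M.trans (x n) (σ.actAlong x n) (x (n + 1)) := by
  classical
  let F : (Finset.Iic n → S) → S → ENNReal := fun h t =>
    if (∀ i, h i = x i) ∧ t = x (n + 1) then 1 else 0
  have hmem : ∀ π : ℕ → S, (∀ i, Preorder.frestrictLe (π := fun _ : ℕ => S) n π i = x i) ↔
      π ∈ pathCylinder n x := fun π => by
    simp [pathCylinder]
  have h := lintegral_pathMeasure_succ σ s n F
  have hl : (fun π : ℕ → S => F (Preorder.frestrictLe n π) (π (n + 1))) =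
      (pathCylinder (n + 1) x).indicator 1 := by
    funext π
    have : π ∈ pathCylinder (n + 1) x ↔ π ∈ pathCylinder n x ∧ π (n + 1) = x (n + 1) := by
      simp only [pathCylinder, Set.mem_ofPred_eq]
      constructor
      · exact fun h => ⟨fun i hi => h i (by omega), h _ le_rfl⟩
      · rintro ⟨h, h'⟩ i hi
        rcases Nat.le_succ_iff.1 hi with hi | rfl
        exacts [h i hi, h']
    simp only [F, hmem, Set.indicator, this, Pi.one_apply]
  have hr : (fun π : ℕ → S => ∫⁻ t, F (Preorder.frestrictLe n π) t
        ∂(M.trans (π n) (σ.actAlong π n)).toMeasure) =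
      (pathCylinder n x).indicator
        fun _ => M.trans (x n) (σ.actAlong x n) (x (n + 1)) := by
    funext π
    by_cases hπ : π ∈ pathCylinder n x
    · have : F (Preorder.frestrictLe n π) = ({x (n + 1)} : Set S).indicator 1 := by
        funext t
        simp only [F, hmem, hπ, true_and, Set.indicator, Set.mem_singleton_iff, Pi.one_apply]
      rw [this, lintegral_indicator_one (measurableSet_singleton _),
        PMF.toMeasure_apply_singleton _ _ (measurableSet_singleton _), Set.indicator_of_mem hπ,
        hπ n le_rfl, σ.actAlong_congr hπ]
    · simp only [F, hmem, hπ, false_and, if_false, lintegral_zero, Set.indicator]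
  rw [hl, hr, lintegral_indicator_one (measurableSet_pathCylinder _ _),
    lintegral_indicator_const (measurableSet_pathCylinder _ _), mul_comm] at h
  rw [h, mul_comm]

theorem pathMeasure_cylinder_congr (σ : M.Scheduler) (s : S) {n : ℕ} {x y : ℕ → S}
    (h : ∀ i ≤ n, x i = y i) :
    M.pathMeasure σ s (pathCylinder n x) = M.pathMeasure σ s (pathCylinder n y) := by
  congr 1
  ext π
  exact forall₂_congr fun i hi => by rw [h i hi]

/-- Positivity of a history thus depends only on the graph of possible transitions. -/
theorem pathMeasure_cylinder_pos_succ (σ : M.Scheduler) (s : S) (n : ℕ) (x : ℕ → S) :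
    0 < M.pathMeasure σ s (pathCylinder (n + 1) x) ↔
      0 < M.pathMeasure σ s (pathCylinder n x) ∧
        x (n + 1) ∈ (M.trans (x n) (σ.actAlong x n)).support := by
  rw [pathMeasure_cylinder_succ, ENNReal.mul_pos_iff, PMF.mem_support_iff, pos_iff_ne_zero,
    pos_iff_ne_zero]

theorem pathMeasure_cylinder_pos_mono (σ : M.Scheduler) (s : S) {n k : ℕ} (x : ℕ → S) (h : k ≤ n)
    (hx : 0 < M.pathMeasure σ s (pathCylinder n x)) :
    0 < M.pathMeasure σ s (pathCylinder k x) :=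
  hx.trans_le (measure_mono fun _ hπ i hi => hπ i (hi.trans h))

theorem eq_of_pathMeasure_cylinder_pos (σ : M.Scheduler) (s : S) {n : ℕ} {x : ℕ → S}
    (hx : 0 < M.pathMeasure σ s (pathCylinder n x)) : x 0 = s := by
  by_contra h
  exact (pathMeasure_cylinder_pos_mono σ s x (Nat.zero_le n) hx).ne'
    (pathMeasure_cylinder_zero_of_ne σ s h)

theorem mem_support_of_pathMeasure_cylinder_pos (σ : M.Scheduler) (s : S) {n i : ℕ} {x : ℕ → S}
    (hx : 0 < M.pathMeasure σ s (pathCylinder n x)) (hi : i < n) :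
    x (i + 1) ∈ (M.trans (x i) (σ.actAlong x i)).support :=
  ((pathMeasure_cylinder_pos_succ σ s i x).1 (pathMeasure_cylinder_pos_mono σ s x hi hx)).2

/-- A history of positive probability extends by every possible successor state. -/
theorem exists_pathMeasure_cylinder_pos_succ (σ : M.Scheduler) (s : S) {n : ℕ} {x : ℕ → S}
    (hx : 0 < M.pathMeasure σ s (pathCylinder n x)) {t : S}
    (ht : t ∈ (M.trans (x n) (σ.actAlong x n)).support) :
    ∃ y : ℕ → S, (∀ i ≤ n, y i = x i) ∧ y (n + 1) = t ∧
      0 < M.pathMeasure σ s (pathCylinder (n + 1) y) := by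
  have h : ∀ i ≤ n, Function.update x (n + 1) t i = x i := fun i hi =>
    Function.update_of_ne (by omega) _ _
  refine ⟨Function.update x (n + 1) t, h, Function.update_self .., ?_⟩
  rw [pathMeasure_cylinder_pos_succ, pathMeasure_cylinder_congr σ s h, σ.actAlong_congr h,
    h n le_rfl, Function.update_self]
  exact ⟨hx, ht⟩

/-- Almost every path has only histories of positive probability. -/
theorem ae_pathMeasure_cylinder_pos (σ : M.Scheduler) (s : S) :
    ∀ᵐ π ∂M.pathMeasure σ s, ∀ n, 0 < M.pathMeasure σ s (pathCylinder n π) := by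
  rw [ae_all_iff]
  intro n
  -- A cylinder is determined by finitely many coordinates in a finite type, so the null cylinders
  -- of length `n` have a null union.
  have hF : Set.Finite (Set.range fun π : ℕ → S => pathCylinder n π) := by
    have : (fun π : ℕ → S => pathCylinder n π) =
        (fun h : Finset.Iic n → S => {π : ℕ → S | ∀ i : Finset.Iic n, π i = h i}) ∘
          Preorder.frestrictLe (π := fun _ : ℕ => S) n := by
      funext π
      ext
      simp [pathCylinder]
    rw [this]
    exact (Set.finite_range _).subset (Set.range_comp_subset_range _ _)
  have h0 : M.pathMeasure σ s (⋃ C ∈ {C | C ∈ Set.range (fun π : ℕ → S => pathCylinder n π) ∧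
      M.pathMeasure σ s C = 0}, C) = 0 :=
    (measure_biUnion_null_iff (hF.subset fun _ h => h.1).countable).2 fun C hC => hC.2
  refine measure_mono_null (fun π hπ => ?_) h0
  simp only [Set.mem_compl_iff, Set.mem_ofPred_eq, not_lt, nonpos_iff_eq_zero] at hπ
  exact Set.mem_biUnion ⟨⟨π, rfl⟩, hπ⟩ fun i _ => rfl

/-- A history of positive probability has an extension with every almost sure property. -/
theorem exists_mem_pathCylinder (σ : M.Scheduler) (s : S) {n : ℕ} {x : ℕ → S}
    (hx : 0 < M.pathMeasure σ s (pathCylinder n x)) {P : (ℕ → S) → Prop}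
    (hP : ∀ᵐ π ∂M.pathMeasure σ s, P π) : ∃ π ∈ pathCylinder n x, P π := by
  by_contra! h
  exact hx.ne' (measure_mono_null h hP)

/-- A path along possible transitions is followed with positive probability by some scheduler. -/
theorem exists_scheduler_follow (M : MDP S Act AP) (x : ℕ → S) (n : ℕ)
    (h : ∀ i < n, ∃ α ∈ M.enabled (x i), x (i + 1) ∈ (M.trans (x i) α).support) :
    ∃ σ : M.Scheduler, 0 < M.pathMeasure σ (x 0) (pathCylinder n x) := by
  have : ∀ i, ∃ α, i < n → α ∈ M.enabled (x i) ∧ x (i + 1) ∈ (M.trans (x i) α).support := by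
    intro i
    by_cases hi : i < n
    · obtain ⟨α, hα⟩ := h i hi
      exact ⟨α, fun _ => hα⟩
    · exact ⟨(M.enabled_nonempty (x 0)).some, fun h => absurd h hi⟩
  choose α hα using this
  -- `l` omits the current state, so its length is the current time.
  refine ⟨M.schedulerOf fun l _ => α l.length, ?_⟩
  have : ∀ k ≤ n, 0 < M.pathMeasure (M.schedulerOf fun l _ => α l.length) (x 0)
      (pathCylinder k x) := by
    intro k
    induction k with
    | zero => intro; rw [pathMeasure_cylinder_zero _ _ rfl]; exact one_pos
    | succ k ih =>
      intro hk
      refine (pathMeasure_cylinder_pos_succ _ _ _ _).2 ⟨ih (by omega), ?_⟩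
      obtain ⟨h1, h2⟩ := hα k hk
      rw [Scheduler.actAlong, schedulerOf_act] <;> simpa using by assumption
  exact this n le_rfl

end Measure

end MDP

/-! ### Attractors and sums over finite types -/

/-- The least set that contains `B` and is closed under the monotone operator `pre`, on a finite
type, with a rank that decreases from each member outside `B`. -/
theorem exists_attractor {S : Type*} [Finite S] (pre : Set S → Set S) (hpre : Monotone pre)
    (B : Set S) : ∃ (W : Set S) (ρ : S → ℕ), B ⊆ W ∧ pre W ⊆ W ∧
      ∀ u ∈ W, u ∈ B ∨ u ∈ pre {t | t ∈ W ∧ ρ t < ρ u} := by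
  classical
  let L : ℕ → Set S := fun n => n.rec B fun _ X => X ∪ pre X
  have hLs : ∀ n, L (n + 1) = L n ∪ pre (L n) := fun _ => rfl
  have hL : Monotone L := monotone_nat_of_le_succ fun n => by
    rw [hLs]; exact Set.subset_union_left
  obtain ⟨N, hN⟩ := WellFoundedGT.monotone_chain_condition ⟨L, hL⟩
  have hN' : ∀ n, L n ⊆ L N := fun n => by
    rcases le_total n N with h | h
    · exact hL h
    · exact (hN n h).ge
  -- The rank is the first stage that contains `u`. Outside `L N` it is the junk value `0`, so the
  -- claim asks for `t ∈ W` beside the rank inequality.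
  refine ⟨L N, fun u => sInf {n | u ∈ L n}, hL (Nat.zero_le N), ?_, fun u hu => ?_⟩
  · exact (Set.subset_union_right.trans (hLs N).ge).trans (hN' (N + 1))
  · have hne : {n | u ∈ L n}.Nonempty := ⟨N, hu⟩
    have hmem : u ∈ L (sInf {n | u ∈ L n}) := Nat.sInf_mem hne
    rcases hk : sInf {n | u ∈ L n} with _ | k
    · rw [hk] at hmem
      exact Or.inl hmem
    · rw [hk, hLs] at hmem
      rcases hmem with h | h
      · have : sInf {n | u ∈ L n} ≤ k := Nat.sInf_le h
        omega
      · have hsub : L k ⊆ {t | t ∈ L N ∧ sInf {n | t ∈ L n} < sInf {n | u ∈ L n}} := fun t ht =>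
          ⟨hN' k ht, (Nat.lt_succ_of_le (Nat.sInf_le ht)).trans_eq hk.symm⟩
        exact Or.inr (hpre hsub h)

/-- Only finitely many sums of a sequence of values of `w` stay below a given bound. -/
theorem finite_setOf_sum_le {S : Type*} [Finite S] (w : S → ℝ≥0) (r : ℝ) :
    {c : ℝ | c ≤ r ∧ ∃ (n : ℕ) (x : ℕ → S), c = ∑ i ∈ Finset.range n, (w (x i) : ℝ)}.Finite := by
  classical
  have := Fintype.ofFinite S
  let g : S → ℕ := fun u => ⌊r / w u⌋₊
  refine ((Set.finite_Iic g).image fun f => ∑ u, (f u : ℝ) * w u).subset ?_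
  rintro c ⟨hc, n, x, rfl⟩
  -- The sum depends only on visit counts, which are at most `r / w u`. States of weight zero
  -- contribute nothing, and their unbounded counts are set to `0`.
  let f : S → ℕ := fun u => if w u = 0 then 0 else ((Finset.range n).filter fun i => x i = u).card
  have hfw : ∀ u, (f u : ℝ) * w u =
      ∑ i ∈ (Finset.range n).filter fun i => x i = u, (w (x i) : ℝ) := by
    intro u
    rw [Finset.sum_congr rfl fun i hi => by rw [(Finset.mem_filter.1 hi).2], Finset.sum_const,
      nsmul_eq_mul]
    by_cases h : w u = 0 <;> simp [f, h]
  refine ⟨f, fun u => ?_, ?_⟩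
  · by_cases h : w u = 0
    · simp [f, h]
    · have hpos : (0 : ℝ) < w u := by exact_mod_cast pos_iff_ne_zero.2 h
      refine Nat.le_floor ((le_div_iff₀ hpos).2 (le_trans ?_ hc))
      rw [hfw]
      exact Finset.sum_le_sum_of_subset_of_nonneg (Finset.filter_subset _ _)
        fun _ _ _ => NNReal.coe_nonneg _
  · simp only [hfw]
    exact Finset.sum_fiberwise _ _ _

/-- A sequence that repeats a term with a positive value periodically has unbounded sums. -/
theorem exists_lt_sum_of_periodic {f : ℕ → ℝ} (hf : ∀ n, 0 ≤ f n) {i d : ℕ} (hd : 0 < d)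
    {c : ℝ} (hc : 0 < c) (h : ∀ q, f (i + q * d) = c) (r : ℝ) :
    ∃ n, r < ∑ m ∈ Finset.range n, f m := by
  obtain ⟨L, hL⟩ := exists_nat_gt (r / c)
  refine ⟨i + L * d, ((div_lt_iff₀ hc).1 hL).trans_le ?_⟩
  have hinj : Set.InjOn (fun q => i + q * d) (Finset.range L) := fun p _ q _ hpq => by
    have : p * d = q * d := by simpa using hpq
    exact Nat.eq_of_mul_eq_mul_right hd this
  calc (L : ℝ) * c = ∑ m ∈ (Finset.range L).image fun q => i + q * d, f m := by
        rw [Finset.sum_image hinj]; simp [h]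
    _ ≤ _ := Finset.sum_le_sum_of_subset_of_nonneg (fun m hm => by
        obtain ⟨q, hq, rfl⟩ := Finset.mem_image.1 hm
        have : q < L := Finset.mem_range.1 hq
        have := Nat.mul_lt_mul_of_pos_right this hd
        exact Finset.mem_range.2 (by omega)) fun _ _ _ => hf _

/-! ### Positive probability within reward `n * c` -/

namespace MDP

variable {S Act AP : Type*} [Finite S] {M : MDP S Act AP}

/-- A path through `a`-labelled states that does not repeat a state of nonzero reward has
accumulated reward at most `n * c`. -/
theorem sum_rew_le (a : AP) {x : ℕ → S} {k : ℕ} (ha : ∀ i < k, a ∈ M.label (x i))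
    (hx : ∀ i j, i < j → j < k → x i = x j → M.rew (x i) = 0) :
    ∑ i ∈ Finset.range k, (M.rew (x i) : ℝ) ≤ (M.labelled a).card * (M.maxReward a : ℝ) := by
  classical
  let I := (Finset.range k).filter fun i => M.rew (x i) ≠ 0
  have hinj : Set.InjOn x I := by
    intro i hi j hj hij
    simp only [I, Finset.coe_filter, Finset.mem_range, Set.mem_ofPred_eq] at hi hj
    rcases lt_trichotomy i j with h | h | h
    · exact absurd (hx i j h hj.1 hij) hi.2
    · exact h
    · exact absurd (hx j i h hi.1 hij.symm) hj.2
  have hsub : I.image x ⊆ M.labelled a := by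
    intro u hu
    obtain ⟨i, hi, rfl⟩ := Finset.mem_image.1 hu
    simpa [labelled] using ha i (Finset.mem_range.1 (Finset.mem_filter.1 hi).1)
  have h : ∑ i ∈ Finset.range k, M.rew (x i) ≤ (M.labelled a).card * M.maxReward a :=
    calc ∑ i ∈ Finset.range k, M.rew (x i) = ∑ i ∈ I, M.rew (x i) :=
          (Finset.sum_filter_ne_zero _).symm
      _ = ∑ u ∈ I.image x, M.rew u := (Finset.sum_image hinj).symm
      _ ≤ ∑ u ∈ M.labelled a, M.rew u := Finset.sum_le_sum_of_subset hsub
      _ ≤ _ := by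
        rw [← nsmul_eq_mul]
        exact Finset.sum_le_card_nsmul _ _ _ fun u hu => Finset.le_sup hu
  exact_mod_cast h

variable [MeasurableSpace S] [DiscreteMeasurableSpace S]

/-- If the rank can decrease under `σ` in each state of `W` outside the target, then the target is
reached with positive probability along a path without repeated states. -/
theorem pathMeasure_untilLE_pos (σ : M.Scheduler) (a b : AP) (W : Set S) (ρ : S → ℕ)
    (hW : ∀ u ∈ W, b ∈ M.label u ∨ a ∈ M.label u ∧
      ∀ l, ∃ t ∈ (M.trans u (σ.act l u)).support, t ∈ W ∧ ρ t < ρ u)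
    {s : S} (hs : s ∈ W) :
    0 < M.pathMeasure σ s (M.untilLE a b ((M.labelled a).card * (M.maxReward a : ℝ))) := by
  -- Strong induction on the rank of the last state: a history of positive probability extends with
  -- falling rank until `b` holds.
  have key : ∀ (m n : ℕ) (x : ℕ → S), ρ (x n) = m → x n ∈ W →
      0 < M.pathMeasure σ s (pathCylinder n x) →
      ∃ (y : ℕ → S) (k : ℕ), n ≤ k ∧ (∀ i ≤ n, y i = x i) ∧
        0 < M.pathMeasure σ s (pathCylinder k y) ∧ b ∈ M.label (y k) ∧
        ∀ i, n ≤ i → i < k → a ∈ M.label (y i) ∧ ρ (y (i + 1)) < ρ (y i) := by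
    intro m
    induction m using Nat.strong_induction_on with
    | _ m ih =>
      intro n x hm hxW hx
      rcases hW _ hxW with hb | ⟨ha, ht⟩
      · exact ⟨x, n, le_rfl, fun _ _ => rfl, hx, hb, fun i h h' => absurd h h'.not_ge⟩
      · obtain ⟨t, ht, htW, hlt⟩ := ht (List.ofFn fun i : Fin n => x i)
        obtain ⟨z, hz, rfl, hz'⟩ := exists_pathMeasure_cylinder_pos_succ σ s hx ht
        obtain ⟨y, k, hk, hy, hy', hb, h⟩ := ih _ (hm ▸ hlt) (n + 1) z rfl htW hz'
        refine ⟨y, k, by omega, fun i hi => (hy i (by omega)).trans (hz i hi), hy', hb, ?_⟩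
        intro i hi hik
        rcases hi.eq_or_lt with rfl | hi
        · rw [hy _ le_rfl, hy _ (by omega), hz _ le_rfl]
          exact ⟨ha, hlt⟩
        · exact h i hi hik
  obtain ⟨y, k, -, -, hy, hb, h⟩ := key (ρ s) 0 (fun _ => s) rfl hs
    (by rw [pathMeasure_cylinder_zero σ s rfl]; exact one_pos)
  have hanti : ∀ i j, i < j → j ≤ k → ρ (y j) < ρ (y i) := by
    intro i j hij
    induction j, hij using Nat.le_induction with
    | base => exact fun hk => (h i (Nat.zero_le i) hk).2
    | succ j hij ih => exact fun hk => (h j (Nat.zero_le j) hk).2.trans (ih (by omega))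
  refine hy.trans_le (measure_mono fun π hπ => ⟨k, ?_, fun i hi => ?_, ?_⟩)
  · rwa [hπ k le_rfl]
  · rw [hπ i hi.le]
    exact (h i (Nat.zero_le i) hi).1
  · rw [Finset.sum_congr rfl fun i hi => by rw [hπ i (Finset.mem_range.1 hi).le]]
    refine sum_rew_le a (fun i hi => (h i (Nat.zero_le i) hi).1) fun i j hij hj he => ?_
    exact absurd (congrArg ρ he) (hanti i j hij hj.le).ne'

/-- If some scheduler fulfils an until property with positive probability, then some scheduler
fulfils it with positive probability within reward `n * c`. -/
theorem exists_pathMeasure_untilLE_pos (a b : AP) (r : ℝ) (s : S)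
    (h : ∃ σ : M.Scheduler, 0 < M.pathMeasure σ s (M.untilLE a b r)) :
    ∃ σ : M.Scheduler, 0 < M.pathMeasure σ s
      (M.untilLE a b ((M.labelled a).card * (M.maxReward a : ℝ))) := by
  classical
  obtain ⟨W, ρ, hB, hpre, hW⟩ := exists_attractor
    (fun T : Set S => {u | a ∈ M.label u ∧ ∃ α ∈ M.enabled u, ∃ t ∈ (M.trans u α).support, t ∈ T})
    (fun T T' hT u hu => by
      obtain ⟨ha, α, hα, t, ht, htT⟩ := hu
      exact ⟨ha, α, hα, t, ht, hT htT⟩) {u | b ∈ M.label u}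
  obtain ⟨σ, hσ⟩ := h
  have hsW : s ∈ W := by
    obtain ⟨π, ⟨k, hb, ha, -⟩, hπ⟩ : ∃ π ∈ M.untilLE a b r,
        ∀ n, 0 < M.pathMeasure σ s (pathCylinder n π) := by
      by_contra! hc
      refine hσ.ne' (measure_mono_null (t := {π | ¬ ∀ n, 0 < M.pathMeasure σ s (pathCylinder n π)})
        (fun π hπ hn => ?_) (ae_pathMeasure_cylinder_pos σ s))
      obtain ⟨n, hn'⟩ := hc π hπ
      exact (hn n).not_ge hn'
    -- Closure under `pre` carries membership in `W` backwards from the target to the initial state.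
    have hk : ∀ j ≤ k, π (k - j) ∈ W := by
      intro j
      induction j with
      | zero => exact fun _ => hB hb
      | succ j ih =>
        intro hj
        refine hpre ⟨ha _ (by omega), σ.actAlong π (k - (j + 1)), σ.actAlong_mem _ _, _,
          mem_support_of_pathMeasure_cylinder_pos σ s (hπ k) (by omega), ?_⟩
        rw [show k - (j + 1) + 1 = k - j by omega]
        exact ih (by omega)
    have := hk k le_rfl
    rwa [Nat.sub_self, eq_of_pathMeasure_cylinder_pos σ s (hπ 0)] at this
  have : ∀ u, ∃ α, u ∈ W → b ∈ M.label u ∨ a ∈ M.label u ∧ α ∈ M.enabled u ∧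
      ∃ t ∈ (M.trans u α).support, t ∈ W ∧ ρ t < ρ u := by
    intro u
    by_cases hu : u ∈ W
    · rcases hW u hu with hb | ⟨ha, α, hα, ht⟩
      · exact ⟨(M.enabled_nonempty u).some, fun _ => Or.inl hb⟩
      · exact ⟨α, fun _ => Or.inr ⟨ha, hα, ht⟩⟩
    · exact ⟨(M.enabled_nonempty u).some, fun h => absurd h hu⟩
  choose f hf using this
  refine ⟨M.schedulerOf fun _ u => f u, pathMeasure_untilLE_pos _ a b W ρ (fun u hu => ?_) hsW⟩
  refine (hf u hu).imp_right fun ⟨ha, hα, ht⟩ => ⟨ha, fun l => ?_⟩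
  rwa [schedulerOf_act M hα]

/-- If every scheduler fulfils an until property with positive probability, then every scheduler
fulfils it with positive probability within reward `n * c`. -/
theorem forall_pathMeasure_untilLE_pos (a b : AP) (r : ℝ) (s : S)
    (h : ∀ σ : M.Scheduler, 0 < M.pathMeasure σ s (M.untilLE a b r)) (σ : M.Scheduler) :
    0 < M.pathMeasure σ s (M.untilLE a b ((M.labelled a).card * (M.maxReward a : ℝ))) := by
  classical
  obtain ⟨W, ρ, hB, hpre, hW⟩ := exists_attractor
    (fun T : Set S => {u | a ∈ M.label u ∧ ∀ α ∈ M.enabled u, ∃ t ∈ (M.trans u α).support, t ∈ T})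
    (fun T T' hT u hu => by
      refine ⟨hu.1, fun α hα => ?_⟩
      obtain ⟨t, ht, htT⟩ := hu.2 α hα
      exact ⟨t, ht, hT htT⟩) {u | b ∈ M.label u}
  refine pathMeasure_untilLE_pos σ a b W ρ (fun u hu => (hW u hu).imp_right fun hu =>
    ⟨hu.1, fun l => hu.2 _ (σ.act_mem l u)⟩) ?_
  by_contra hsW
  -- Outside `W`, an `a`-state has an action that surely stays outside. A scheduler that always
  -- plays it avoids `b` as long as `a` holds, against `h`.
  have : ∀ u, ∃ α ∈ M.enabled u, u ∉ W → a ∈ M.label u →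
      ∀ t ∈ (M.trans u α).support, t ∉ W := by
    intro u
    by_cases hu : u ∉ W ∧ a ∈ M.label u
    · have : u ∉ {u | a ∈ M.label u ∧ ∀ α ∈ M.enabled u, ∃ t ∈ (M.trans u α).support, t ∈ W} :=
        fun h => hu.1 (hpre h)
      simp only [Set.mem_ofPred_eq, not_and, not_forall, not_exists] at this
      obtain ⟨α, hα, ht⟩ := this hu.2
      exact ⟨α, hα, fun _ _ => ht⟩
    · exact ⟨_, (M.enabled_nonempty u).some_mem, fun h h' => absurd ⟨h, h'⟩ hu⟩
  choose f hf hf' using this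
  refine (h (M.schedulerOf fun _ u => f u)).ne' (measure_mono_null ?_
    (ae_pathMeasure_cylinder_pos (M.schedulerOf fun _ u => f u) s))
  rintro π ⟨k, hb, ha, -⟩ hπ
  have hk : ∀ i ≤ k, π i ∉ W := by
    intro i
    induction i with
    | zero => intro; rwa [eq_of_pathMeasure_cylinder_pos _ s (hπ 0)]
    | succ i ih =>
      intro hi
      refine hf' (π i) (ih (by omega)) (ha i hi) _ ?_
      have := mem_support_of_pathMeasure_cylinder_pos _ s (hπ k) hi
      rwa [Scheduler.actAlong, schedulerOf_act M (hf _)] at this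
  exact hk k le_rfl (hB hb)

/-! ### Probability one under all schedulers -/

/-- If every scheduler fulfils an until property almost surely, then every scheduler fulfils it
almost surely within reward `n * c`. -/
theorem forall_ae_mem_untilLE (a b : AP) (r : ℝ) (s : S)
    (h : ∀ σ : M.Scheduler, ∀ᵐ π ∂M.pathMeasure σ s, π ∈ M.untilLE a b r) (σ : M.Scheduler) :
    ∀ᵐ π ∂M.pathMeasure σ s,
      π ∈ M.untilLE a b ((M.labelled a).card * (M.maxReward a : ℝ)) := by
  classical
  filter_upwards [h σ, ae_pathMeasure_cylinder_pos σ s] with π hπ hpos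
  have hex : ∃ k, b ∈ M.label (π k) := hπ.imp fun k hk => hk.1
  have hmin : ∀ i < Nat.find hex, b ∉ M.label (π i) := fun i hi => Nat.find_min hex hi
  have hb := Nat.find_spec hex
  generalize Nat.find hex = k at hmin hb
  have ha : ∀ i < k, a ∈ M.label (π i) := by
    obtain ⟨k', hb', ha', -⟩ := hπ
    have : k ≤ k' := by
      by_contra hlt
      exact hmin k' (by omega) hb'
    exact fun i hi => ha' i (by omega)
  refine ⟨k, hb, ha, sum_rew_le a ha fun i j hij hj he => ?_⟩
  by_contra hrew
  let d := j - i
  have hd : 0 < d := by omega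
  -- The path `π` up to time `i`, then the loop from `i` to `j` forever. Each step of `y` is a step
  -- of `π` before `k`; the wrap-around uses `π i = π j`.
  let y : ℕ → S := fun m => if m < i then π m else π (i + (m - i) % d)
  have hidx : ∀ m, ∃ l < k, y m = π l ∧ y (m + 1) = π (l + 1) := by
    intro m
    by_cases h1 : m < i
    · refine ⟨m, by omega, if_pos h1, ?_⟩
      by_cases h2 : m + 1 < i
      · exact if_pos h2
      · have h3 : i = m + 1 := by omega
        simp [y, h3]
    · have h4 := Nat.mod_lt (m - i) hd
      refine ⟨i + (m - i) % d, by omega, if_neg h1, ?_⟩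
      have h5 : y (m + 1) = π (i + (m - i + 1) % d) := by
        have : m + 1 - i = m - i + 1 := by omega
        simp only [y, this]
        rw [if_neg (by omega)]
      rw [h5, Nat.add_mod]
      by_cases h6 : (m - i) % d + 1 = d
      · have h7 : (m - i) % d + 1 % d = d ∨ (m - i) % d + 1 % d = 0 := by
          rcases Nat.lt_or_ge 1 d with h1d | h1d
          · rw [Nat.mod_eq_of_lt h1d]; exact Or.inl h6
          · have : d = 1 := by omega
            rw [this]; right; omega
        have h8 : ((m - i) % d + 1 % d) % d = 0 := by
          rcases h7 with h7 | h7 <;> rw [h7] <;> simp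
        rw [h8, show i + (m - i) % d + 1 = j by omega]
        exact he
      · have h1d : 1 < d := by omega
        rw [Nat.mod_eq_of_lt h1d, Nat.mod_eq_of_lt (by omega), add_assoc]
  have hyb : ∀ m, b ∉ M.label (y m) := fun m => by
    obtain ⟨l, hl, h1, -⟩ := hidx m
    rw [h1]; exact hmin l hl
  have hyq : ∀ q, y (i + q * d) = π i := fun q => by simp [y]
  obtain ⟨n, hn⟩ := exists_lt_sum_of_periodic (f := fun m => (M.rew (y m) : ℝ))
    (fun m => NNReal.coe_nonneg _) hd (c := M.rew (π i))
    (by exact_mod_cast pos_iff_ne_zero.2 hrew) (fun q => by rw [hyq]) r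
  obtain ⟨τ, hτ⟩ := exists_scheduler_follow M y n fun m _ => by
    obtain ⟨l, hl, h1, h2⟩ := hidx m
    rw [h1, h2]
    exact ⟨_, σ.actAlong_mem π l, mem_support_of_pathMeasure_cylinder_pos σ s (hpos k) hl⟩
  have hy0 : y 0 = s := by
    rw [← eq_of_pathMeasure_cylinder_pos σ s (hpos 0)]
    rcases Nat.eq_zero_or_pos i with rfl | h0
    · simp [y]
    · simp [y, h0]
  rw [hy0] at hτ
  obtain ⟨η, hη, k', hb', -, hr⟩ := exists_mem_pathCylinder τ s hτ (h τ)
  -- After time `n` the budget `r` is already exceeded, and up to time `n` the path agrees with `y`,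
  -- which never meets `b`.
  rcases Nat.lt_or_ge n k' with hlt | hle
  · refine (hn.trans_le ?_).not_ge hr
    rw [Finset.sum_congr rfl fun m hm => by rw [← hη m (Finset.mem_range.1 hm).le]]
    exact Finset.sum_le_sum_of_subset_of_nonneg (Finset.range_mono hlt.le)
      fun _ _ _ => NNReal.coe_nonneg _
  · exact hyb k' (hη k' hle ▸ hb')

end MDP

/-! ### Almost sure reachability and probability one under some scheduler -/

namespace MDP

/-- The nonzero transition probabilities have a common positive lower bound. -/
theorem exists_le_trans {S Act AP : Type*} [Finite S] [Finite Act] (M : MDP S Act AP) :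
    ∃ p : ℝ, 0 < p ∧ p ≤ 1 ∧
      ∀ u α, ∀ t ∈ (M.trans u α).support, p ≤ (M.trans u α t).toReal := by
  have hfin : (insert 1 {q : ℝ | ∃ u α, ∃ t ∈ (M.trans u α).support,
      q = (M.trans u α t).toReal}).Finite := by
    refine Set.Finite.insert _ ((Set.finite_range fun z : S × Act × S =>
      (M.trans z.1 z.2.1 z.2.2).toReal).subset ?_)
    rintro _ ⟨u, α, t, -, rfl⟩
    exact ⟨(u, α, t), rfl⟩
  obtain ⟨p, hp, hmin⟩ := Set.exists_min_image _ id hfin ⟨1, Set.mem_insert _ _⟩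
  refine ⟨p, ?_, hmin 1 (Set.mem_insert _ _),
    fun u α t ht => hmin _ (Set.mem_insert_of_mem _ ⟨u, α, t, ht, rfl⟩)⟩
  rcases hp with rfl | ⟨u, α, t, ht, rfl⟩
  · exact one_pos
  · exact ENNReal.toReal_pos ht (PMF.apply_ne_top _ _)

variable {S Act AP : Type*} [Finite S] [MeasurableSpace S] [DiscreteMeasurableSpace S]
  {M : MDP S Act AP}

/-- If a nonnegative function that is bounded below outside `B` decreases in expectation by a
constant factor, then `B` is reached almost surely. -/
theorem ae_exists_mem_of_contraction (σ : M.Scheduler) (s : S) (W B : Set S)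
    (g : S → ENNReal) (c d : ENNReal) (hd : d < 1) (hc : c ≠ 0) (hg1 : ∀ u, g u ≤ 1)
    (hgB : ∀ u ∈ W, u ∉ B → c ≤ g u)
    (hg : ∀ u ∈ W, u ∉ B → ∀ l,
      ∫⁻ t, Bᶜ.indicator g t ∂(M.trans u (σ.act l u)).toMeasure ≤ d * g u)
    (hW : ∀ᵐ π ∂M.pathMeasure σ s, (∀ i, π i ∉ B) → ∀ i, π i ∈ W) :
    ∀ᵐ π ∂M.pathMeasure σ s, ∃ k, π k ∈ B := by
  classical
  let N : ℕ → Set (ℕ → S) := fun n => {π | ∀ i ≤ n, π i ∈ W ∧ π i ∉ B}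
  let A : (n : ℕ) → Set (Finset.Iic n → S) := fun n => {h | ∀ i, h i ∈ W ∧ h i ∉ B}
  have hNA : ∀ n π, π ∈ N n ↔ Preorder.frestrictLe (π := fun _ : ℕ => S) n π ∈ A n := by
    intro n π
    simp [N, A]
  have hNm : ∀ n, MeasurableSet (N n) := by
    intro n
    have : N n = Preorder.frestrictLe (π := fun _ : ℕ => S) n ⁻¹' A n := by
      ext π; exact hNA n π
    rw [this]
    exact Preorder.measurable_frestrictLe n MeasurableSet.of_discrete
  -- The expectation of `g` on paths still in `W` and outside `B` shrinks by the factor `d` per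
  -- step. As `g ≥ c` there, the probability of such paths tends to `0`.
  let X : ℕ → ENNReal := fun n => ∫⁻ π, (N n).indicator (fun π => g (π n)) π ∂M.pathMeasure σ s
  have hX : ∀ n, X n ≤ d ^ n := by
    intro n
    induction n with
    | zero =>
      calc X 0 ≤ ∫⁻ _, 1 ∂M.pathMeasure σ s := lintegral_mono fun π =>
            (Set.indicator_le_self _ _ _).trans (hg1 _)
        _ = d ^ 0 := by simp
    | succ n ih =>
      calc X (n + 1) ≤ ∫⁻ π, (A n).indicator
              (fun _ => Bᶜ.indicator g (π (n + 1)))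
              (Preorder.frestrictLe n π) ∂M.pathMeasure σ s := by
            refine lintegral_mono fun π => ?_
            by_cases hπ : π ∈ N (n + 1)
            · have h1 : Preorder.frestrictLe (π := fun _ : ℕ => S) n π ∈ A n :=
                (hNA n π).1 fun i hi => hπ i (by omega)
              have h2 : π (n + 1) ∈ Bᶜ := (hπ (n + 1) le_rfl).2
              simp only [Set.indicator_of_mem hπ, Set.indicator_of_mem h1, Set.indicator_of_mem h2]
              exact le_rfl
            · simp only [Set.indicator_of_notMem hπ]
              exact bot_le
        _ = ∫⁻ π, ∫⁻ t, (A n).indicator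
              (fun _ => Bᶜ.indicator g t) (Preorder.frestrictLe n π)
              ∂(M.trans (π n) (σ.actAlong π n)).toMeasure ∂M.pathMeasure σ s :=
            lintegral_pathMeasure_succ σ s n fun h t => (A n).indicator
              (fun _ => Bᶜ.indicator g t) h
        _ ≤ ∫⁻ π, d * (N n).indicator (fun π => g (π n)) π ∂M.pathMeasure σ s := by
            refine lintegral_mono fun π => ?_
            by_cases hπ : π ∈ N n
            · have h1 := (hNA n π).1 hπ
              simp only [Set.indicator_of_mem hπ, Set.indicator_of_mem h1]
              exact hg _ (hπ n le_rfl).1 (hπ n le_rfl).2 _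
            · have h1 := fun h => hπ ((hNA n π).2 h)
              simp only [Set.indicator_of_notMem h1, lintegral_zero]
              exact bot_le
        _ = d * X n := lintegral_const_mul' _ _ (hd.trans_le le_top).ne
        _ ≤ d ^ (n + 1) := by
            rw [pow_succ']
            gcongr
  have hle : ∀ n, c * M.pathMeasure σ s (⋂ n, N n) ≤ d ^ n := by
    intro n
    refine le_trans ?_ (hX n)
    calc c * M.pathMeasure σ s (⋂ n, N n) ≤ c * M.pathMeasure σ s (N n) := by
          gcongr; exact Set.iInter_subset _ _
      _ = ∫⁻ π, (N n).indicator (fun _ => c) π ∂M.pathMeasure σ s :=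
          (lintegral_indicator_const (hNm n) c).symm
      _ ≤ X n := lintegral_mono fun π => by
          by_cases hπ : π ∈ N n
          · simp only [Set.indicator_of_mem hπ]
            exact hgB _ (hπ n le_rfl).1 (hπ n le_rfl).2
          · simp only [Set.indicator_of_notMem hπ, le_refl]
  have h0 : c * M.pathMeasure σ s (⋂ n, N n) ≤ 0 :=
    ge_of_tendsto' (ENNReal.tendsto_pow_atTop_nhds_zero_of_lt_one hd) hle
  have h1 : M.pathMeasure σ s (⋂ n, N n) = 0 :=
    (mul_eq_zero.1 (nonpos_iff_eq_zero.1 h0)).resolve_left hc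
  have h2 : ∀ᵐ π ∂M.pathMeasure σ s, π ∉ ⋂ n, N n := measure_eq_zero_iff_ae_notMem.1 h1
  filter_upwards [h2, hW] with π hπ hπW
  by_contra! hne
  exact hπ (Set.mem_iInter.2 fun n i _ => ⟨hπW hne i, hne i⟩)

/-- If `W` is closed under the transitions of `σ` outside `B`, and there the rank can decrease,
then `B` is reached almost surely. -/
theorem ae_exists_mem_of_rank [Finite Act] (σ : M.Scheduler) {s : S} (W B : Set S) (ρ : S → ℕ)
    (hs : s ∈ W)
    (hW : ∀ u ∈ W, u ∉ B → ∀ l, (∀ t ∈ (M.trans u (σ.act l u)).support, t ∈ W) ∧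
      ∃ t ∈ (M.trans u (σ.act l u)).support, ρ t < ρ u) :
    ∀ᵐ π ∂M.pathMeasure σ s, ∃ k, π k ∈ B := by
  classical
  obtain ⟨p, hp0, hp1, hp⟩ := M.exists_le_trans
  obtain ⟨R, hR⟩ : ∃ R, ∀ u, ρ u ≤ R := by
    obtain ⟨R, hR⟩ := (Set.finite_range ρ).bddAbove
    exact ⟨R, fun u => hR ⟨u, rfl⟩⟩
  -- The contracting function is `1 - θ ^ ρ`. A successor of lower rank has probability at least `p
  -- = 2 * θ`, so the next expectation is at most `1 - 2 * θ ^ ρ u`; as `θ ^ R ≤ θ ^ ρ u`, this is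
  -- below `(1 - θ ^ R) * (1 - θ ^ ρ u)`.
  let θ := p / 2
  have hθ0 : 0 < θ := by positivity
  have hθ1 : θ ≤ 1 / 2 := by simp only [θ]; linarith
  have hpow : ∀ n, θ ^ n ≤ 1 := fun n => pow_le_one₀ hθ0.le (by linarith)
  refine ae_exists_mem_of_contraction σ s W B (fun u => ENNReal.ofReal (1 - θ ^ ρ u))
    (ENNReal.ofReal (1 / 2)) (ENNReal.ofReal (1 - θ ^ R)) ?_ ?_ ?_ ?_ ?_ ?_
  · rw [ENNReal.ofReal_lt_one]
    have := pow_pos hθ0 R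
    linarith
  · simp
  · intro u
    rw [ENNReal.ofReal_le_one]
    have := pow_pos hθ0 (ρ u)
    linarith
  · intro u hu huB
    obtain ⟨t, -, ht⟩ := (hW u hu huB []).2
    refine ENNReal.ofReal_le_ofReal ?_
    -- Outside `B` the rank is at least `1`, since some successor has a smaller one.
    have : θ ^ ρ u ≤ θ ^ 1 := pow_le_pow_of_le_one hθ0.le (by linarith) (by omega)
    linarith [pow_one θ]
  · intro u hu huB l
    obtain ⟨t, ht, htρ⟩ := (hW u hu huB l).2
    set q := M.trans u (σ.act l u) with hq
    have hb : ∀ v, Bᶜ.indicator (fun u => ENNReal.ofReal (1 - θ ^ ρ u)) v ≤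
        ENNReal.ofReal (1 - ({t} : Set S).indicator (fun _ => θ ^ ρ t) v) := by
      intro v
      refine (Set.indicator_le_self _ _ _).trans (ENNReal.ofReal_le_ofReal ?_)
      by_cases hv : v = t
      · simp [hv]
      · rw [Set.indicator_of_notMem (by simpa using hv)]
        linarith [pow_pos hθ0 (ρ v)]
    refine (lintegral_mono hb).trans ?_
    rw [← ofReal_integral_eq_lintegral_ofReal Integrable.of_finite
      (Filter.Eventually.of_forall fun v => ?_), ← ENNReal.ofReal_mul (by linarith [hpow R])]
    · refine ENNReal.ofReal_le_ofReal ?_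
      rw [integral_sub Integrable.of_finite Integrable.of_finite,
        integral_indicator_const _ (measurableSet_singleton t), Measure.real,
        PMF.toMeasure_apply_singleton _ _ (measurableSet_singleton _)]
      simp only [integral_const, probReal_univ, smul_eq_mul, one_mul]
      have h1 : 2 * θ ^ ρ u ≤ (q t).toReal * θ ^ ρ t := by
        have h2 : θ ^ ρ u ≤ θ ^ (ρ t + 1) := pow_le_pow_of_le_one hθ0.le (by linarith) htρ
        have h3 : p * θ ^ ρ t ≤ (q t).toReal * θ ^ ρ t := by
          gcongr
          exact hp _ _ _ ht
        have h4 : θ ^ (ρ t + 1) = p / 2 * θ ^ ρ t := by rw [pow_succ']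
        linarith
      have h5 : θ ^ R ≤ θ ^ ρ u := pow_le_pow_of_le_one hθ0.le (by linarith) (hR u)
      have h6 : 0 ≤ θ ^ R * θ ^ ρ u := by positivity
      linarith
    · by_cases hv : v = t
      · simp [hv, hpow]
      · simp [hv]
  · filter_upwards [ae_pathMeasure_cylinder_pos σ s] with π hπ hB i
    induction i with
    | zero => rwa [eq_of_pathMeasure_cylinder_pos σ s (hπ 0)]
    | succ i ih =>
      exact (hW _ ih (hB i) _).1 _
        (mem_support_of_pathMeasure_cylinder_pos σ s (hπ (i + 1)) (Nat.lt_succ_self i))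

/-- If some scheduler fulfils an until property almost surely, then some scheduler fulfils it
almost surely within reward `n * c`. -/
theorem exists_ae_mem_untilLE [Finite Act] (a b : AP) (r : ℝ) (s : S)
    (h : ∃ σ : M.Scheduler, ∀ᵐ π ∂M.pathMeasure σ s, π ∈ M.untilLE a b r) :
    ∃ σ : M.Scheduler, ∀ᵐ π ∂M.pathMeasure σ s,
      π ∈ M.untilLE a b ((M.labelled a).card * (M.maxReward a : ℝ)) := by
  classical
  obtain ⟨σ, hσ⟩ := h
  have hae := hσ.and (ae_pathMeasure_cylinder_pos σ s)
  let cost : ℕ → (ℕ → S) → ℝ := fun n x => ∑ i ∈ Finset.range n, (M.rew (x i) : ℝ)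
  have hcost : ∀ {n : ℕ} {x y : ℕ → S}, (∀ i < n, x i = y i) → cost n x = cost n y :=
    fun h => Finset.sum_congr rfl fun i hi => by rw [h i (Finset.mem_range.1 hi)]
  have hcost_mono : ∀ x, Monotone fun n => cost n x := fun x m n hmn =>
    Finset.sum_le_sum_of_subset_of_nonneg (Finset.range_mono hmn) fun _ _ _ => NNReal.coe_nonneg _
  -- Here `e` is the budget left when a history of positive probability under `σ` arrives at `u`
  -- without an earlier `b`.
  let Wins : S → ℝ → Prop := fun u e => ∃ (n : ℕ) (x : ℕ → S),
    0 < M.pathMeasure σ s (pathCylinder n x) ∧ (∀ i < n, b ∉ M.label (x i)) ∧ x n = u ∧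
      e = r - cost n x
  have wins_nonneg : ∀ {u e}, Wins u e → 0 ≤ e := by
    rintro u e ⟨n, x, hx, hb, -, rfl⟩
    obtain ⟨π, hπ, ⟨k, hk, -, hr⟩, -⟩ := exists_mem_pathCylinder σ s hx hae
    have hnk : n ≤ k := by
      by_contra hlt
      exact hb k (by omega) (hπ k (by omega) ▸ hk)
    rw [← hcost fun i hi => hπ i (Nat.le_of_lt hi)]
    exact sub_nonneg.2 ((hcost_mono π hnk).trans hr)
  -- Finiteness makes the least budget `v u` an attained minimum.
  have wins_finite : ∀ u, {e | Wins u e}.Finite := by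
    intro u
    refine ((finite_setOf_sum_le M.rew r).image fun q => r - q).subset fun e he => ?_
    have h0 := wins_nonneg he
    obtain ⟨n, x, -, -, -, rfl⟩ := he
    exact ⟨cost n x, ⟨by linarith, n, x, rfl⟩, rfl⟩
  have wins_step : ∀ {n : ℕ} {x : ℕ → S}, 0 < M.pathMeasure σ s (pathCylinder n x) →
      (∀ i ≤ n, b ∉ M.label (x i)) → a ∈ M.label (x n) ∧
        ∀ t ∈ (M.trans (x n) (σ.actAlong x n)).support,
          Wins t (r - cost n x - M.rew (x n)) := by
    intro n x hx hb
    constructor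
    · obtain ⟨π, hπ, ⟨k, hk, ha, -⟩, -⟩ := exists_mem_pathCylinder σ s hx hae
      have hnk : n < k := by
        by_contra hlt
        exact hb k (by omega) (hπ k (by omega) ▸ hk)
      rw [← hπ n le_rfl]
      exact ha n hnk
    · intro t ht
      obtain ⟨y, hy, hyt, hpos⟩ := exists_pathMeasure_cylinder_pos_succ σ s hx ht
      refine ⟨n + 1, y, hpos, fun i hi => ?_, hyt, ?_⟩
      · rw [hy i (by omega)]
        exact hb i (by omega)
      · have h1 : cost (n + 1) y = cost n y + M.rew (y n) := Finset.sum_range_succ _ _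
        rw [h1, hy n le_rfl, hcost fun i hi => hy i (Nat.le_of_lt hi)]
        ring
  have : ∀ u, ∃ e, (∃ e', Wins u e') → Wins u e ∧ ∀ e', Wins u e' → e ≤ e' := by
    intro u
    by_cases hu : ∃ e', Wins u e'
    · obtain ⟨e, he, hmin⟩ := Set.exists_min_image _ id (wins_finite u) hu
      exact ⟨e, fun _ => ⟨he, hmin⟩⟩
    · exact ⟨0, fun h => absurd h hu⟩
  choose v hv using this
  let W : Set S := {u | ∃ e, Wins u e}
  let ok : S → Act → Prop := fun u α => α ∈ M.enabled u ∧
    ∀ t ∈ (M.trans u α).support, t ∈ W ∧ v t + M.rew u ≤ v u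
  obtain ⟨T, ρ, hB, hpre, hT⟩ := exists_attractor
    (fun T : Set S => {u | a ∈ M.label u ∧ ∃ α, ok u α ∧ ∃ t ∈ (M.trans u α).support, t ∈ T})
    (fun T T' hT u hu => by
      obtain ⟨ha, α, hα, t, ht, htT⟩ := hu
      exact ⟨ha, α, hα, t, ht, hT htT⟩) {u | b ∈ M.label u}
  have hWT : W ⊆ T := by
    by_contra hne
    -- Take `u` with least `v` outside `T`, and follow `σ` from a history that attains `v u` to the
    -- first `b`. While the path is outside `T`, minimality gives `r - cost i π ≤ v u ≤ v (π i)`, so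
    -- the choice of `σ` is `ok`; a step into `T` would put `π i` into `T`. Hence the path never
    -- enters `T`, yet it ends in `b`.
    obtain ⟨u, ⟨hu, huT⟩, hmin⟩ := Set.exists_min_image (W \ T) v (Set.toFinite _)
      (Set.sdiff_nonempty.2 hne)
    obtain ⟨n, x, hx, hb, rfl, he⟩ := (hv u hu).1
    obtain ⟨π, hπ, hπr, hpos⟩ := exists_mem_pathCylinder σ s hx hae
    have hex : ∃ k, b ∈ M.label (π k) := hπr.imp fun k hk => hk.1
    have hbmin : ∀ i < Nat.find hex, b ∉ M.label (π i) := fun i hi => Nat.find_min hex hi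
    have hbk := Nat.find_spec hex
    generalize Nat.find hex = k at hbmin hbk
    have hnk : n ≤ k := by
      by_contra hlt
      exact hb k (by omega) (hπ k (by omega) ▸ hbk)
    have hall : ∀ i, n ≤ i → i ≤ k → π i ∉ T := by
      intro i hi
      induction i, hi using Nat.le_induction with
      | base => exact fun _ => hπ n le_rfl ▸ huT
      | succ i hi ih =>
        intro hik hmem
        have hiT := ih (by omega)
        have hwin : Wins (π i) (r - cost i π) :=
          ⟨i, π, hpos i, fun j hj => hbmin j (by omega), rfl, rfl⟩
        have h1 : v (x n) ≤ v (π i) := hmin _ ⟨⟨_, hwin⟩, hiT⟩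
        have h2 : cost n x ≤ cost i π := by
          rw [← hcost fun i hi => hπ i (Nat.le_of_lt hi)]
          exact hcost_mono π hi
        obtain ⟨ha, hsucc⟩ := wins_step (hpos i) fun j hj => hbmin j (by omega)
        refine hiT (hpre ⟨ha, σ.actAlong π i, ⟨σ.actAlong_mem π i, fun t ht => ?_⟩, _,
          mem_support_of_pathMeasure_cylinder_pos σ s (hpos k) hik, hmem⟩)
        have h3 := (hv t ⟨_, hsucc t ht⟩).2 _ (hsucc t ht)
        exact ⟨⟨_, hsucc t ht⟩, by linarith⟩
    exact hall k hnk le_rfl (hB hbk)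
  have : ∀ u, ∃ α, u ∈ W → b ∉ M.label u → a ∈ M.label u ∧ ok u α ∧
      ∃ t ∈ (M.trans u α).support, ρ t < ρ u := by
    intro u
    by_cases hu : u ∈ W ∧ b ∉ M.label u
    · rcases hT u (hWT hu.1) with h | ⟨ha, α, hα, t, ht, -, hlt⟩
      · exact absurd h hu.2
      · exact ⟨α, fun _ _ => ⟨ha, hα, t, ht, hlt⟩⟩
    · exact ⟨(M.enabled_nonempty u).some, fun h h' => absurd ⟨h, h'⟩ hu⟩
  choose f hf using this
  let τ := M.schedulerOf fun _ u => f u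
  have hτ : ∀ u ∈ W, b ∉ M.label u → ∀ l, τ.act l u = f u := fun u hu hb l =>
    schedulerOf_act M (hf u hu hb).2.1.1
  have hsW : s ∈ W := ⟨_, 0, fun _ => s, by rw [pathMeasure_cylinder_zero σ s rfl]; exact one_pos,
    fun i hi => absurd hi (Nat.not_lt_zero i), rfl, rfl⟩
  have hhit := ae_exists_mem_of_rank τ W {u | b ∈ M.label u} ρ hsW fun u hu hb l => by
    rw [hτ u hu hb]
    obtain ⟨-, hok, ht⟩ := hf u hu hb
    exact ⟨fun t ht => (hok.2 t ht).1, ht⟩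
  refine ⟨τ, ?_⟩
  filter_upwards [hhit, ae_pathMeasure_cylinder_pos τ s] with π hex hpos
  have hbmin : ∀ i < Nat.find hex, b ∉ M.label (π i) := fun i hi => Nat.find_min hex hi
  have hbk : b ∈ M.label (π (Nat.find hex)) := Nat.find_spec hex
  generalize Nat.find hex = k at hbmin hbk
  have hstep : ∀ i < k, π i ∈ W → π (i + 1) ∈ W ∧ v (π (i + 1)) + M.rew (π i) ≤ v (π i) := by
    intro i hi hiW
    have h1 := mem_support_of_pathMeasure_cylinder_pos τ s (hpos k) hi
    rw [Scheduler.actAlong, hτ _ hiW (hbmin i hi)] at h1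
    exact (hf _ hiW (hbmin i hi)).2.1.2 _ h1
  have hπW : ∀ i ≤ k, π i ∈ W := by
    intro i
    induction i with
    | zero => intro; rwa [eq_of_pathMeasure_cylinder_pos τ s (hpos 0)]
    | succ i ih => exact fun hi => (hstep i hi (ih (by omega))).1
  have hanti : ∀ i j, i < j → j ≤ k → v (π j) + M.rew (π i) ≤ v (π i) := by
    intro i j hij
    induction j, hij using Nat.le_induction with
    | base => exact fun hk => (hstep i hk (hπW i (by omega))).2
    | succ j hij ih =>
      intro hk
      have h1 := (hstep j hk (hπW j (by omega))).2
      have h2 := ih (by omega)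
      linarith [NNReal.coe_nonneg (M.rew (π j))]
  have ha : ∀ i < k, a ∈ M.label (π i) := fun i hi => (hf _ (hπW i hi.le) (hbmin i hi)).1
  refine ⟨k, hbk, ha, sum_rew_le a ha fun i j hij hj he => ?_⟩
  have h1 := hanti i j hij hj.le
  rw [← he] at h1
  have h2 : (M.rew (π i) : ℝ) ≤ 0 := by linarith
  exact_mod_cast le_antisymm h2 (NNReal.coe_nonneg _)

end MDP

/-! ### Duality and the value of a query -/

/-- The dual of a path quantifier. -/
def PathQuantifier.dual : PathQuantifier → PathQuantifier
  | .all => .ex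
  | .ex => .all

/-- The negation of a comparison operator. -/
def Comparison.neg : Comparison → Comparison
  | .lt => .ge
  | .le => .gt
  | .ge => .lt
  | .gt => .le

theorem Comparison.neg_holds (c : Comparison) (x p : ℝ) :
    c.neg.Holds x p ↔ ¬ c.Holds x p := by
  cases c <;> simp [Comparison.neg, Comparison.Holds]

/-- The query that is satisfied exactly where `φ` is not. -/
def QuantileQuery.dual {AP : Type*} (φ : QuantileQuery AP) : QuantileQuery AP :=
  { φ with quant := φ.quant.dual, cmp := φ.cmp.neg }

namespace MDP

variable {S Act AP : Type*}

theorem untilLE_mono (M : MDP S Act AP) (a b : AP) : Monotone (M.untilLE a b) :=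
  fun _ _ h _ ⟨k, hb, ha, hr⟩ => ⟨k, hb, ha, hr.trans h⟩

variable [Finite S] [MeasurableSpace S] [DiscreteMeasurableSpace S] {M : MDP S Act AP}

theorem sat_dual (φ : QuantileQuery AP) (s : S) (r : ℝ) : M.Sat s φ.dual r ↔ ¬ M.Sat s φ r := by
  obtain ⟨q, c, p, a, b⟩ := φ
  cases q <;> simp [Sat, QuantileQuery.dual, PathQuantifier.dual, Comparison.neg_holds]

theorem sat_mono {φ : QuantileQuery AP} (hφ : φ.cmp = .ge ∨ φ.cmp = .gt) (s : S) {r r' : ℝ}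
    (hr : r ≤ r') (h : M.Sat s φ r) : M.Sat s φ r' := by
  have hm : ∀ σ : M.Scheduler, (M.pathMeasure σ s).real (M.untilLE φ.lhs φ.rhs r) ≤
      (M.pathMeasure σ s).real (M.untilLE φ.lhs φ.rhs r') := fun σ =>
    measureReal_mono (M.untilLE_mono _ _ hr)
  have hc : ∀ {x y : ℝ}, x ≤ y → φ.cmp.Holds x φ.bound → φ.cmp.Holds y φ.bound := by
    intro x y hxy h
    rcases hφ with hφ | hφ <;> rw [hφ] at h ⊢
    · exact le_trans h hxy
    · exact lt_of_lt_of_le h hxy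
  unfold Sat at h ⊢
  split at h
  · exact fun σ => hc (hm σ) (h σ)
  · exact h.imp fun σ => hc (hm σ)

theorem one_le_real_iff_ae (σ : M.Scheduler) (s : S) (a b : AP) (r : ℝ) :
    1 ≤ (M.pathMeasure σ s).real (M.untilLE a b r) ↔
      ∀ᵐ π ∂M.pathMeasure σ s, π ∈ M.untilLE a b r := by
  have h : (∀ᵐ π ∂M.pathMeasure σ s, π ∈ M.untilLE a b r) ↔
      M.pathMeasure σ s (M.untilLE a b r) = 1 :=
    mem_ae_iff_prob_eq_one (M.measurableSet_untilLE a b r)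
  rw [h]
  constructor
  · intro h1
    have h2 := le_antisymm measureReal_le_one h1
    rwa [Measure.real, ENNReal.toReal_eq_one_iff] at h2
  · intro h1
    rw [Measure.real, h1, ENNReal.toReal_one]

theorem real_pos_iff (σ : M.Scheduler) (s : S) (a b : AP) (r : ℝ) :
    0 < (M.pathMeasure σ s).real (M.untilLE a b r) ↔
      0 < M.pathMeasure σ s (M.untilLE a b r) := by
  simp [Measure.real, ENNReal.toReal_pos_iff]

/-- A qualitative lower-bound query that holds for some reward bound holds for `n * c`. -/
theorem sat_card_mul_maxReward [Finite Act] {φ : QuantileQuery AP} (hφ : φ.IsQualitative)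
    (hc : φ.cmp = .ge ∨ φ.cmp = .gt) (s : S) {r : ℝ} (h : M.Sat s φ r) :
    M.Sat s φ ((M.labelled φ.lhs).card * (M.maxReward φ.lhs : ℝ)) := by
  obtain ⟨q, c, p, a, b⟩ := φ
  have hact : M.Scheduler := M.schedulerOf fun _ u => (M.enabled_nonempty u).some
  have hle : ∀ (σ : M.Scheduler) (r : ℝ), ¬ 1 < (M.pathMeasure σ s).real (M.untilLE a b r) :=
    fun σ r => measureReal_le_one.not_gt
  simp only at hc
  rcases hφ with rfl | rfl <;> rcases hc with rfl | rfl <;> cases q <;>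
    simp only [Sat, Comparison.Holds, Set.Icc.coe_zero, Set.Icc.coe_one, ge_iff_le,
      gt_iff_lt, one_le_real_iff_ae, real_pos_iff] at h ⊢
  · exact fun σ => measureReal_nonneg
  · exact ⟨hact, measureReal_nonneg⟩
  · exact forall_pathMeasure_untilLE_pos a b r s h
  · exact exists_pathMeasure_untilLE_pos a b r s h
  · exact forall_ae_mem_untilLE a b r s h
  · exact exists_ae_mem_untilLE a b r s h
  · exact absurd (h hact) (hle hact r)
  · obtain ⟨σ, hσ⟩ := h
    exact absurd hσ (hle σ r)

/-- The value of a lower-bound query is at most `B` if the query holds for `B` as soon as it holds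
for some bound. -/
theorem val_le_of_lower {φ : QuantileQuery AP} (hc : φ.cmp = .ge ∨ φ.cmp = .gt) {s : S} {B : ℝ}
    (hB : ∀ r, M.Sat s φ r → M.Sat s φ B) (hs : M.val φ s < ⊤) : M.val φ s ≤ B := by
  have hval : M.val φ s = sInf ((fun r : ℝ => (r : EReal)) '' {r : ℝ | M.Sat s φ r}) := by
    unfold val
    rcases hc with h | h <;> rw [h]
  rw [hval] at hs ⊢
  obtain ⟨_, ⟨r, hr, rfl⟩, -⟩ := sInf_lt_iff.1 hs
  exact sInf_le ⟨B, hB r hr, rfl⟩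

/-- The value of an upper-bound query is at most `B` if the dual query holds for `B` as soon as it
holds for some bound. -/
theorem val_le_of_upper {φ : QuantileQuery AP} (hc : φ.cmp = .lt ∨ φ.cmp = .le) {s : S} {B : ℝ}
    (hB : ∀ r, M.Sat s φ.dual r → M.Sat s φ.dual B) (hs : M.val φ s < ⊤) : M.val φ s ≤ B := by
  have hval : M.val φ s = sSup ((fun r : ℝ => (r : EReal)) '' {r : ℝ | M.Sat s φ r}) := by
    unfold val
    rcases hc with h | h <;> rw [h]
  have hc' : φ.dual.cmp = .ge ∨ φ.dual.cmp = .gt := by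
    simp only [QuantileQuery.dual]
    rcases hc with h | h <;> rw [h] <;> simp [Comparison.neg]
  rw [hval] at hs ⊢
  obtain ⟨r, hr⟩ : ∃ r, ¬ M.Sat s φ r := by
    by_contra! hall
    -- If every real bound satisfied `φ`, the supremum would be `⊤`.
    refine hs.ne (top_unique (le_of_forall_lt fun x hx => ?_))
    obtain ⟨y, hxy, -⟩ := EReal.lt_iff_exists_real_btwn.1 hx
    exact hxy.trans_le (le_sSup ⟨y, hall y, rfl⟩)
  have hsat := hB r ((sat_dual φ s r).2 hr)
  refine sSup_le ?_
  rintro _ ⟨r', hr', rfl⟩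
  refine EReal.coe_le_coe_iff.2 (le_of_not_gt fun hlt => ?_)
  exact (sat_dual φ s r').1 (sat_mono hc' s hlt.le hsat) hr'

end MDP

theorem mainTheorem10 {S Act AP : Type*} [Finite S] [Finite Act]
    [MeasurableSpace S] [DiscreteMeasurableSpace S]
    (M : MDP S Act AP) (φ : QuantileQuery AP) (hφ : φ.IsQualitative)
    (s : S) (hs : M.val φ s < ⊤) :
    M.val φ s ≤ ((((M.labelled φ.lhs).card : ℝ) * (M.maxReward φ.lhs : ℝ) : ℝ) : EReal) := by
  -- Dualizing leaves the probability bound unchanged.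
  have hd : φ.dual.IsQualitative := hφ
  rcases hc : φ.cmp with _ | _ | _ | _
  · exact MDP.val_le_of_upper (Or.inl hc) (fun r => MDP.sat_card_mul_maxReward hd
      (Or.inl (by simp [QuantileQuery.dual, hc, Comparison.neg])) s) hs
  · exact MDP.val_le_of_upper (Or.inr hc) (fun r => MDP.sat_card_mul_maxReward hd
      (Or.inr (by simp [QuantileQuery.dual, hc, Comparison.neg])) s) hs
  · exact MDP.val_le_of_lower (Or.inl hc) (fun r => MDP.sat_card_mul_maxReward hφ (Or.inl hc) s) hs
  · exact MDP.val_le_of_lower (Or.inr hc) (fun r => MDP.sat_card_mul_maxReward hφ (Or.inr hc) s) hs
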